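/- Let $K$ be an algebraically closed field and let $\mathcal H$ be a finitely generated commutative Hopf algebra over $K$, that is, the representing Hopf algebra of an affine group scheme of finite type over $K$ (in particular, $\mathcal H$ may be the representing Hopf algebra of a finite group scheme). Then there is exactly one $K$-algebra homomorphism $\mathcal H\to K$ (i.e. the affine scheme represented by $\mathcal H$ has exactly one $K$-rational point) if and only if (a) $\mathcal H=K$, i.e. the structure map $K\to\mathcal H$ is bijective, or (b) $K$ has prime characteristic $p$ and there are an integer $n\ge 1$ and integers $e_1,\dots,e_n\ge 1$ such that, as $K$-algebras, $$\mathcal H\cong K[x_1,\ldots,x_n]/(x_1^{p^{e_1}},\ldots,x_n^{p^{e_n}}).$$ -/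

import Mathlib

open TensorProduct

/-! ### Tangent vectors and invariant derivations -/

section
variable {K A : Type*} [Field K] [CommRing A] [Algebra K A]

/-! Let `m` be the kernel of the counit `ε`. By the Nullstellensatz a unique point makes `m` nil, so
`H` is finite-dimensional and local. A tangent vector `ξ` extends to the derivation `(id ⊗ ξ) ∘ Δ`,
whose value at the identity is `ξ`; inverting a matrix that is the identity modulo `m` gives
derivations dual to any family independent in `m/m²` (`exists_dual_derivations`).

In characteristic zero a nilpotent `x` cannot have `D x = 1`, so `m = m²` and Nakayama gives `m =
0`.

In characteristic `p`, derivations kill the subalgebra `A^p`, so the monomials in `d = dim m/m²`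
coordinates with exponents below `p` are independent over it: `p^d * dim A^p ≤ dim A`
(`pow_card_mul_finrank_le`). As `A^p` inherits a comultiplication and is smaller unless `m = m²`,
induction applies: `p`-th roots of a good cotangent basis of `A^p`, completed by elements with `z^p
= 0`, form one of `A` (`HasTruncatedBasis.of_frobeniusRange`). Its elements generate `A`, so a
truncated polynomial algebra of dimension at most `p^(∑ e_i) ≤ dim A` surjects onto `A`, necessarily
isomorphically.

Conversely, a point of a truncated polynomial algebra sends every nilpotent variable to zero. -/

/-- The span of the constants and the square of the kernel of an augmentation `ε`. The quotient
of `A` by it is the cotangent space at `ε`. -/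
def constSupSq (ε : A →ₐ[K] K) : Submodule K A :=
  Submodule.span K {1} ⊔ ((RingHom.ker ε) ^ 2).restrictScalars K

theorem one_mem_constSupSq (ε : A →ₐ[K] K) : (1 : A) ∈ constSupSq ε :=
  Submodule.mem_sup_left (Submodule.mem_span_singleton_self 1)

theorem mem_constSupSq_of_mem_sq (ε : A →ₐ[K] K) {a : A} (ha : a ∈ (RingHom.ker ε) ^ 2) :
    a ∈ constSupSq ε :=
  Submodule.mem_sup_right ha

theorem algebraMap_mem_constSupSq (ε : A →ₐ[K] K) (c : K) : algebraMap K A c ∈ constSupSq ε := by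
  rw [Algebra.algebraMap_eq_smul_one]
  exact Submodule.smul_mem _ _ (one_mem_constSupSq ε)

theorem mem_constSupSq_iff (ε : A →ₐ[K] K) {a : A} :
    a ∈ constSupSq ε ↔ ∃ c : K, ∃ w ∈ (RingHom.ker ε) ^ 2, a = algebraMap K A c + w := by
  constructor
  · intro h
    obtain ⟨u, hu, w, hw, rfl⟩ := Submodule.mem_sup.mp h
    obtain ⟨c, rfl⟩ := Submodule.mem_span_singleton.mp hu
    exact ⟨c, w, hw, by rw [Algebra.algebraMap_eq_smul_one]⟩
  · rintro ⟨c, w, hw, rfl⟩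
    exact add_mem (algebraMap_mem_constSupSq ε c) (mem_constSupSq_of_mem_sq ε hw)

theorem sub_algebraMap_mem_ker (ε : A →ₐ[K] K) (a : A) :
    a - algebraMap K A (ε a) ∈ RingHom.ker ε := by
  simp [RingHom.mem_ker]

theorem map_mul_of_constSupSq_le_ker (ε : A →ₐ[K] K) {ξ : A →ₗ[K] K}
    (hξ : constSupSq ε ≤ LinearMap.ker ξ) (a b : A) : ξ (a * b) = ε a * ξ b + ε b * ξ a := by
  have h1 : ξ 1 = 0 := hξ (one_mem_constSupSq ε)
  have h2 : ξ ((a - algebraMap K A (ε a)) * (b - algebraMap K A (ε b))) = 0 := by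
    refine hξ (mem_constSupSq_of_mem_sq ε ?_)
    rw [pow_two]
    exact Ideal.mul_mem_mul (sub_algebraMap_mem_ker ε a) (sub_algebraMap_mem_ker ε b)
  have h3 : (a - algebraMap K A (ε a)) * (b - algebraMap K A (ε b)) =
      a * b - ε a • b - ε b • a + (ε a * ε b) • (1 : A) := by
    simp only [Algebra.smul_def, map_mul]; ring
  rw [h3] at h2
  simp only [map_add, map_sub, map_smul, smul_eq_mul, h1] at h2
  linear_combination h2

/-- The linear map `a ⊗ b ↦ ξ b • a`. -/
def applyRight (ξ : A →ₗ[K] K) : A ⊗[K] A →ₗ[K] A :=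
  TensorProduct.lift ((LinearMap.lsmul K A) ∘ₗ ξ).flip

@[simp] theorem applyRight_tmul (ξ : A →ₗ[K] K) (a b : A) :
    applyRight ξ (a ⊗ₜ[K] b) = ξ b • a := by
  simp [applyRight]

/-- The algebra map `a ⊗ b ↦ ε b • a`. -/
def evalRight (ε : A →ₐ[K] K) : A ⊗[K] A →ₐ[K] A :=
  Algebra.TensorProduct.productMap (AlgHom.id K A) ((Algebra.ofId K A).comp ε)

/-- The algebra map `a ⊗ b ↦ ε a • b`. -/
def evalLeft (ε : A →ₐ[K] K) : A ⊗[K] A →ₐ[K] A :=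
  Algebra.TensorProduct.productMap ((Algebra.ofId K A).comp ε) (AlgHom.id K A)

@[simp] theorem evalRight_tmul (ε : A →ₐ[K] K) (a b : A) :
    evalRight ε (a ⊗ₜ[K] b) = ε b • a := by
  simp [evalRight, Algebra.ofId_apply, Algebra.smul_def, mul_comm]

@[simp] theorem evalLeft_tmul (ε : A →ₐ[K] K) (a b : A) :
    evalLeft ε (a ⊗ₜ[K] b) = ε a • b := by
  simp [evalLeft, Algebra.ofId_apply, Algebra.smul_def]

theorem applyRight_mul (ε : A →ₐ[K] K) {ξ : A →ₗ[K] K}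
    (hξ : constSupSq ε ≤ LinearMap.ker ξ) (u v : A ⊗[K] A) :
    applyRight ξ (u * v) =
      evalRight ε u * applyRight ξ v + evalRight ε v * applyRight ξ u := by
  induction u with
  | zero => simp
  | add x y hx hy => simp only [add_mul, map_add, hx, hy]; ring
  | tmul a b =>
    induction v with
    | zero => simp
    | add x y hx hy => simp only [mul_add, map_add, hx, hy]; ring
    | tmul c d =>
      simp only [Algebra.TensorProduct.tmul_mul_tmul, applyRight_tmul, evalRight_tmul,
        map_mul_of_constSupSq_le_ker ε hξ, Algebra.smul_def, map_add, map_mul]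
      ring

/-- The translation-invariant derivation attached to a tangent vector `ξ`. -/
def invariantDerivation (ε : A →ₐ[K] K) (Δ : A →ₐ[K] A ⊗[K] A)
    (hr : ∀ a, evalRight ε (Δ a) = a) (ξ : A →ₗ[K] K)
    (hξ : constSupSq ε ≤ LinearMap.ker ξ) : Derivation K A A :=
  Derivation.mk' (applyRight ξ ∘ₗ Δ.toLinearMap) fun a b => by
    simp [applyRight_mul ε hξ, hr]

/-- With the left counit law this shows that the invariant derivation of `ξ` takes the value `ξ` at
the identity. -/
theorem map_applyRight (ε : A →ₐ[K] K) (ξ : A →ₗ[K] K) (u : A ⊗[K] A) :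
    ε (applyRight ξ u) = ξ (evalLeft ε u) := by
  induction u with
  | zero => simp
  | add x y hx hy => simp only [map_add, hx, hy]
  | tmul a b => simp [mul_comm]

theorem map_invariantDerivation (ε : A →ₐ[K] K) (Δ : A →ₐ[K] A ⊗[K] A)
    (hr : ∀ a, evalRight ε (Δ a) = a) (hl : ∀ a, evalLeft ε (Δ a) = a) (ξ : A →ₗ[K] K)
    (hξ : constSupSq ε ≤ LinearMap.ker ξ) (a : A) :
    ε (invariantDerivation ε Δ hr ξ hξ a) = ξ a := by
  change ε (applyRight ξ (Δ a)) = ξ a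
  rw [map_applyRight, hl]

theorem isUnit_of_map_ne_zero {ε : A →ₐ[K] K} (hε : ∀ a, ε a = 0 → IsNilpotent a) {a : A}
    (ha : ε a ≠ 0) : IsUnit a := by
  have h : IsNilpotent (a - algebraMap K A (ε a)) := hε _ (sub_algebraMap_mem_ker ε a)
  have hu : IsUnit (algebraMap K A (ε a)) := (IsUnit.mk0 _ ha).map _
  simpa using h.isUnit_add_left_of_commute hu (mul_comm _ _)

/-- Elements that are linearly independent in the cotangent space at the identity admit
dual derivations. -/
theorem exists_dual_derivations {ε : A →ₐ[K] K} (hε : ∀ a, ε a = 0 → IsNilpotent a)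
    (Δ : A →ₐ[K] A ⊗[K] A) (hr : ∀ a, evalRight ε (Δ a) = a) (hl : ∀ a, evalLeft ε (Δ a) = a)
    {ι : Type*} [Finite ι] [DecidableEq ι] {x : ι → A}
    (hx : LinearIndependent K fun i => (constSupSq ε).mkQ (x i)) :
    ∃ D : ι → Derivation K A A, ∀ i j, D i (x j) = if i = j then 1 else 0 := by
  have := Fintype.ofFinite ι
  have hex : ∀ i, ∃ ξ : A →ₗ[K] K, constSupSq ε ≤ LinearMap.ker ξ ∧
      ∀ j, ξ (x j) = if i = j then 1 else 0 := by
    intro i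
    -- Dual functionals on the cotangent space: coordinates on the span, extended arbitrarily.
    obtain ⟨g, hg⟩ := LinearMap.exists_extend (hx.repr : _ →ₗ[K] (ι →₀ K))
    refine ⟨Finsupp.lapply i ∘ₗ g ∘ₗ (constSupSq ε).mkQ, ?_, ?_⟩
    · intro a ha
      have : (constSupSq ε).mkQ a = 0 := by simpa using ha
      simp only [LinearMap.mem_ker, LinearMap.comp_apply, this, map_zero]
    · intro j
      have hj := LinearMap.congr_fun hg
        ⟨(constSupSq ε).mkQ (x j), Submodule.subset_span ⟨j, rfl⟩⟩
      simp only [LinearMap.comp_apply, Submodule.subtype_apply] at hj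
      rw [hx.repr_eq_single j _ rfl] at hj
      simp only [LinearMap.comp_apply, hj, Finsupp.lapply_apply, Finsupp.single_apply, eq_comm]
  choose ξ hξ hξx using hex
  let E : ι → Derivation K A A := fun i => invariantDerivation ε Δ hr (ξ i) (hξ i)
  let M : Matrix ι ι A := Matrix.of fun i j => E i (x j)
  have hM : ε M.det = 1 := by
    have : ε.toRingHom.mapMatrix M = 1 := by
      ext i j
      simp [M, E, Matrix.one_apply, map_invariantDerivation ε Δ hr hl, hξx]
    have h2 := RingHom.map_det ε.toRingHom M
    rw [this, Matrix.det_one] at h2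
    exact h2
  have hu : IsUnit M.det := isUnit_of_map_ne_zero hε (by rw [hM]; exact one_ne_zero)
  -- The invariant derivations are dual to `x` only modulo `ker ε`; the inverse matrix corrects
  -- this.
  refine ⟨fun i => ∑ k, M⁻¹ i k • E k, fun i j => ?_⟩
  have h : (M⁻¹ * M) i j = (1 : Matrix ι ι A) i j := by rw [Matrix.nonsing_inv_mul M hu]
  rw [Matrix.mul_apply, Matrix.one_apply] at h
  rw [← h]
  change (∑ k, M⁻¹ i k • E k) (x j) = _
  rw [show (∑ k, M⁻¹ i k • E k) (x j) = ∑ k, (M⁻¹ i k • E k) (x j) from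
    (congrFun (map_sum (Derivation.coeFnAddMonoidHom (R := K) (A := A) (M := A)) _ _) (x j)).trans (Finset.sum_apply _ _ _)]
  simp [M]

end

/-! ### Derivations against nilpotents and against `p`-th powers -/

section
variable {K A : Type*} [Field K] [CommRing A] [Algebra K A]

theorem constSupSq_eq_top_of_charZero [CharZero K] {ε : A →ₐ[K] K}
    (hε : ∀ a, ε a = 0 → IsNilpotent a) (Δ : A →ₐ[K] A ⊗[K] A)
    (hr : ∀ a, evalRight ε (Δ a) = a) (hl : ∀ a, evalLeft ε (Δ a) = a) :
    constSupSq ε = ⊤ := by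
  have : Nontrivial A := ε.toRingHom.domain_nontrivial
  have : CharZero A := charZero_of_injective_algebraMap (algebraMap K A).injective
  by_contra hne
  obtain ⟨a, ha⟩ : ∃ a, a ∉ constSupSq ε := by
    by_contra! h
    exact hne (eq_top_iff.mpr fun a _ => h a)
  have hx : LinearIndependent K fun _ : Unit =>
      (constSupSq ε).mkQ (a - algebraMap K A (ε a)) := by
    refine LinearIndependent.of_subsingleton () ?_
    intro h
    refine ha ?_
    simpa using add_mem ((Submodule.Quotient.mk_eq_zero _).mp h)
      (algebraMap_mem_constSupSq ε (ε a))
  obtain ⟨D, hD⟩ := exists_dual_derivations hε Δ hr hl hx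
  set x := a - algebraMap K A (ε a) with hxdef
  have hDx : D () x = 1 := by simpa using hD () ()
  have key : ∀ n : ℕ, x ^ n ≠ 0 := by
    intro n
    induction n with
    | zero => simp
    | succ n ih =>
      intro h
      -- Since `D x = 1`, this reads `(n + 1) x ^ n = 0`, and `n + 1` is invertible.
      have h2 : D () (x ^ (n + 1)) = 0 := by rw [h, map_zero]
      rw [Derivation.leibniz_pow, hDx] at h2
      have h3 : ((n + 1 : ℕ) : A) * x ^ n = 0 := by simpa [nsmul_eq_mul] using h2
      have hu : IsUnit (((n + 1 : ℕ) : A)) := by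
        have : IsUnit (algebraMap K A ((n + 1 : ℕ) : K)) :=
          (IsUnit.mk0 _ (Nat.cast_ne_zero.mpr n.succ_ne_zero)).map _
        simpa using this
      exact ih ((hu.mul_right_eq_zero).mp h3)
  obtain ⟨n, hn⟩ := hε x (by simp [hxdef])
  exact key n hn

theorem derivation_aeval {R ι : Type*} [CommRing R] [Algebra R A] [DecidableEq ι]
    {x : ι → A} {D : ι → Derivation K A A} (hD : ∀ i j, D i (x j) = if i = j then 1 else 0)
    (hR : ∀ i r, D i (algebraMap R A r) = 0) (i : ι) (P : MvPolynomial ι R) :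
    D i (MvPolynomial.aeval x P) = MvPolynomial.aeval x (MvPolynomial.pderiv i P) := by
  induction P using MvPolynomial.induction_on with
  | C a => simp [hR]
  | add p q hp hq => simp [hp, hq]
  | mul_X p j hp =>
    simp only [map_mul, Derivation.leibniz, MvPolynomial.aeval_X, hD, hp, smul_eq_mul,
      MvPolynomial.pderiv_X, map_add, Pi.single_apply]
    by_cases h : i = j
    · subst h; simp
    · simp [h, Ne.symm h]

/-- In characteristic `p`, elements with dual `R`-linear derivations satisfy no polynomial
relation over `R` of degree less than `p` in each variable. -/
theorem eq_zero_of_aeval_eq_zero {R ι : Type*} [CommRing R] [Algebra R A] [DecidableEq ι]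
    [FaithfulSMul R A] (p : ℕ) [hp : Fact p.Prime] [CharP R p]
    {x : ι → A} {D : ι → Derivation K A A} (hD : ∀ i j, D i (x j) = if i = j then 1 else 0)
    (hR : ∀ i r, D i (algebraMap R A r) = 0) (N : ℕ) (P : MvPolynomial ι R)
    (hP : ∀ m, P.coeff m ≠ 0 → (∀ i, m i < p) ∧ m.degree ≤ N)
    (h0 : MvPolynomial.aeval x P = 0) : P = 0 := by
  induction N generalizing P with
  | zero =>
    have hC : P = MvPolynomial.C (P.coeff 0) := by
      ext m
      rw [MvPolynomial.coeff_C]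
      split_ifs with h
      · rw [h]
      · by_contra hm
        exact h ((Finsupp.degree_eq_zero_iff m).mp (Nat.le_zero.mp (hP m hm).2)).symm
    rw [hC, MvPolynomial.aeval_C] at h0
    rw [hC, (FaithfulSMul.algebraMap_injective R A) (h0.trans (map_zero _).symm), map_zero]
  | succ N ih =>
    -- Applying `D i` to the relation gives a relation of smaller degree, with coefficients those of
    -- the partial derivative.
    have hpd : ∀ i, MvPolynomial.pderiv i P = 0 := by
      intro i
      refine ih _ ?_ ?_
      · intro m hm
        rw [MvPolynomial.coeff_pderiv] at hm
        obtain ⟨h1, h2⟩ := hP _ (left_ne_zero_of_mul hm)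
        constructor
        · intro j
          refine lt_of_le_of_lt ?_ (h1 j)
          simp
        · rw [map_add, Finsupp.degree_single] at h2
          omega
      · rw [← derivation_aeval hD hR, h0, map_zero]
    refine ih P ?_ h0
    intro m hm
    refine ⟨(hP m hm).1, ?_⟩
    -- If `m i ≠ 0`, then `0 < m i < p` is invertible, so the vanishing partial derivative kills the
    -- coefficient at `m`.
    suffices m = 0 by simp [this]
    by_contra hne
    obtain ⟨i, hi⟩ := Finsupp.ne_iff.mp hne
    have hi' : m i ≠ 0 := by simpa using hi
    have hmi : m - Finsupp.single i 1 + Finsupp.single i 1 = m :=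
      tsub_add_cancel_of_le (by simpa [Finsupp.single_le_iff] using Nat.one_le_iff_ne_zero.mpr hi')
    have hc := congrArg (MvPolynomial.coeff (m - Finsupp.single i 1)) (hpd i)
    rw [MvPolynomial.coeff_pderiv, hmi, MvPolynomial.coeff_zero] at hc
    have hcast : ((((m - Finsupp.single i 1 : ι →₀ ℕ) i : ℕ)) : R) + 1 = ((m i : ℕ) : R) := by
      rw [← Nat.cast_add_one]
      congr 1
      simp
      omega
    rw [hcast] at hc
    have hu : IsUnit ((m i : ℕ) : R) := by
      rw [CharP.isUnit_natCast_iff hp.out]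
      exact fun hd => absurd (Nat.le_of_dvd (Nat.pos_of_ne_zero hi') hd) (not_le.mpr ((hP m hm).1 i))
    exact hm (hu.mul_left_eq_zero.mp hc)

section Frobenius
variable (K A) (p : ℕ) [hp : Fact p.Prime] [CharP K p] [CharP A p] [PerfectRing K p]

/-- The subalgebra of `p`-th powers, over a perfect field of characteristic `p`. -/
def frobeniusRange : Subalgebra K A :=
  { (frobenius A p).range with
    algebraMap_mem' := fun c => ⟨algebraMap K A ((frobeniusEquiv K p).symm c), by
      rw [frobenius_def, ← map_pow, frobeniusEquiv_symm_pow_p]⟩ }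

variable {K A}

theorem mem_frobeniusRange {a : A} : a ∈ frobeniusRange K A p ↔ ∃ b, b ^ p = a := Iff.rfl

theorem derivation_frobeniusRange (D : Derivation K A A) (b : frobeniusRange K A p) :
    D b = 0 := by
  obtain ⟨a, ha⟩ := (mem_frobeniusRange p).mp b.2
  rw [← ha, Derivation.leibniz_pow]
  simp [← Nat.cast_smul_eq_nsmul A]

instance charP_frobeniusRange : CharP (frobeniusRange K A p) p :=
  ⟨fun n => by rw [← CharP.cast_eq_zero_iff A p, ← Subtype.coe_inj]; simp⟩

theorem pow_card_mul_finrank_le [Module.Finite K A] {ε : A →ₐ[K] K}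
    (hε : ∀ a, ε a = 0 → IsNilpotent a) (Δ : A →ₐ[K] A ⊗[K] A)
    (hr : ∀ a, evalRight ε (Δ a) = a) (hl : ∀ a, evalLeft ε (Δ a) = a)
    {ι : Type*} [Fintype ι] {x : ι → A}
    (hx : LinearIndependent K fun i => (constSupSq ε).mkQ (x i)) :
    p ^ Fintype.card ι * Module.finrank K (frobeniusRange K A p) ≤ Module.finrank K A := by
  classical
  obtain ⟨D, hD⟩ := exists_dual_derivations hε Δ hr hl hx
  let expo : (ι → Fin p) → ι →₀ ℕ := fun α => Finsupp.equivFunOnFinite.symm fun i => (α i : ℕ)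
  have hexpo : Function.Injective expo := by
    intro α β h
    ext i
    exact DFunLike.congr_fun h i
  -- Coefficients in `A^p` indexed by exponents below `p`; evaluating at `x` will embed this
  -- `K`-space in `A`.
  let F : ((ι → Fin p) → frobeniusRange K A p) →ₗ[K] MvPolynomial ι (frobeniusRange K A p) :=
    ∑ α, ((MvPolynomial.monomial (expo α)).restrictScalars K) ∘ₗ LinearMap.proj α
  have hF : ∀ f, F f = ∑ α, MvPolynomial.monomial (expo α) (f α) := by
    intro f
    simp [F]
  let G : ((ι → Fin p) → frobeniusRange K A p) →ₗ[K] A :=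
    ((MvPolynomial.aeval x : MvPolynomial ι (frobeniusRange K A p) →ₐ[_] A).toLinearMap.restrictScalars
      K) ∘ₗ F
  have hG : Function.Injective G := by
    rw [injective_iff_map_eq_zero]
    intro f hf
    have hzero : F f = 0 := by
      refine eq_zero_of_aeval_eq_zero (R := frobeniusRange K A p) p hD
        (fun i r => derivation_frobeniusRange p (D i) r) (∑ _i : ι, p) _ ?_ hf
      intro m hm
      rw [hF, MvPolynomial.coeff_sum] at hm
      obtain ⟨α, -, hα⟩ := Finset.exists_ne_zero_of_sum_ne_zero hm
      rw [MvPolynomial.coeff_monomial] at hα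
      have hmα : expo α = m := by
        by_contra h
        exact hα (if_neg h)
      subst hmα
      refine ⟨fun i => (α i).2, ?_⟩
      rw [Finsupp.degree_eq_sum]
      exact Finset.sum_le_sum fun i _ => (α i).2.le
    funext α
    have h := congrArg (MvPolynomial.coeff (expo α)) hzero
    rw [hF, MvPolynomial.coeff_sum, MvPolynomial.coeff_zero] at h
    simpa [MvPolynomial.coeff_monomial, hexpo.eq_iff] using h
  have h := LinearMap.finrank_le_finrank_of_injective hG
  rwa [Module.finrank_pi_fintype, Finset.sum_const, Finset.card_univ, Fintype.card_fun,
    Fintype.card_fin, smul_eq_mul] at h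

end Frobenius
end

/-! ### The induced structure on the subalgebra of `p`-th powers -/

section
variable {K A : Type*} [Field K] [CommRing A] [Algebra K A]
variable (p : ℕ) [hp : Fact p.Prime] [CharP K p] [CharP A p] [PerfectRing K p]

theorem evalRight_map_val (B : Subalgebra K A) (ε : A →ₐ[K] K) (u : B ⊗[K] B) :
    evalRight ε (Algebra.TensorProduct.map B.val B.val u) = evalRight (ε.comp B.val) u := by
  induction u with
  | zero => simp
  | add x y hx hy => simp only [map_add, hx, hy, Subalgebra.coe_add]
  | tmul a b => simp

theorem evalLeft_map_val (B : Subalgebra K A) (ε : A →ₐ[K] K) (u : B ⊗[K] B) :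
    evalLeft ε (Algebra.TensorProduct.map B.val B.val u) = evalLeft (ε.comp B.val) u := by
  induction u with
  | zero => simp
  | add x y hx hy => simp only [map_add, hx, hy, Subalgebra.coe_add]
  | tmul a b => simp

/-- Frobenius is additive and sends `a ⊗ b` to `a^p ⊗ b^p`. Hence `Δ (a^p) = (Δ a)^p` lies in the
image of `A^p ⊗ A^p`. -/
theorem pow_mem_range_map_val [CharP (A ⊗[K] A) p] (u : A ⊗[K] A) :
    u ^ p ∈ (Algebra.TensorProduct.map (frobeniusRange K A p).val
      (frobeniusRange K A p).val).range := by
  induction u with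
  | zero => rw [zero_pow hp.out.ne_zero]; exact zero_mem _
  | add x y hx hy => rw [add_pow_char]; exact add_mem hx hy
  | tmul a b =>
    rw [Algebra.TensorProduct.tmul_pow]
    exact ⟨⟨a ^ p, a, rfl⟩ ⊗ₜ ⟨b ^ p, b, rfl⟩, by simp⟩

/-- A comultiplication restricts to the subalgebra of `p`-th powers. -/
theorem exists_comul_frobeniusRange (ε : A →ₐ[K] K) (Δ : A →ₐ[K] A ⊗[K] A) :
    ∃ Δ' : frobeniusRange K A p →ₐ[K] frobeniusRange K A p ⊗[K] frobeniusRange K A p,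
      ∀ b, Algebra.TensorProduct.map (frobeniusRange K A p).val (frobeniusRange K A p).val (Δ' b) =
        Δ b := by
  set B := frobeniusRange K A p
  have : Nontrivial A := ε.toRingHom.domain_nontrivial
  have : Nontrivial (A ⊗[K] A) := (evalRight ε).toRingHom.domain_nontrivial
  have : CharP (A ⊗[K] A) p := charP_of_injective_algebraMap (algebraMap K (A ⊗[K] A)).injective p
  let j := Algebra.TensorProduct.map B.val B.val
  have hj : Function.Injective j :=
    TensorProduct.map_injective_of_flat_flat B.val.toLinearMap B.val.toLinearMap
      Subtype.val_injective Subtype.val_injective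
  have hmem : ∀ b : B, (Δ.comp B.val) b ∈ j.range := by
    rintro ⟨b, a, rfl⟩
    have := pow_mem_range_map_val (K := K) p (Δ a)
    rwa [← map_pow] at this
  refine ⟨(AlgEquiv.ofInjective j hj).symm.toAlgHom.comp ((Δ.comp B.val).codRestrict _ hmem),
    fun b => ?_⟩
  have h := (AlgEquiv.ofInjective j hj).apply_symm_apply ((Δ.comp B.val).codRestrict _ hmem b)
  exact congrArg Subtype.val h

variable (K A) in
/-- The Frobenius map onto the subalgebra of `p`-th powers. -/
def frobeniusOnto : A →+* frobeniusRange K A p :=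
  (frobenius A p).codRestrict (frobeniusRange K A p) fun a => ⟨a, rfl⟩

theorem coe_frobeniusOnto (a : A) : (frobeniusOnto K A p a : A) = a ^ p := rfl

theorem frobeniusOnto_surjective : Function.Surjective (frobeniusOnto K A p) := by
  rintro ⟨b, a, rfl⟩
  exact ⟨a, rfl⟩

theorem frobeniusOnto_smul (c : K) (a : A) :
    frobeniusOnto K A p (c • a) = c ^ p • frobeniusOnto K A p a :=
  Subtype.ext (by simp [coe_frobeniusOnto, smul_pow])

theorem comp_val_frobeniusOnto (ε : A →ₐ[K] K) (a : A) :
    ε.comp (frobeniusRange K A p).val (frobeniusOnto K A p a) = ε a ^ p := by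
  simp [coe_frobeniusOnto]

theorem map_frobeniusOnto_ker (ε : A →ₐ[K] K) :
    (RingHom.ker ε).map (frobeniusOnto K A p) =
      RingHom.ker (ε.comp (frobeniusRange K A p).val) := by
  ext b
  rw [Ideal.mem_map_iff_of_surjective _ (frobeniusOnto_surjective p)]
  constructor
  · rintro ⟨a, ha, rfl⟩
    rw [RingHom.mem_ker] at ha ⊢
    rw [comp_val_frobeniusOnto, ha, zero_pow hp.out.ne_zero]
  · intro hb
    obtain ⟨a, rfl⟩ := frobeniusOnto_surjective p b
    rw [RingHom.mem_ker, comp_val_frobeniusOnto] at hb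
    exact ⟨a, eq_zero_of_pow_eq_zero hb, rfl⟩

theorem frobeniusOnto_mem_constSupSq {ε : A →ₐ[K] K} {a : A} (ha : a ∈ constSupSq ε) :
    frobeniusOnto K A p a ∈ constSupSq (ε.comp (frobeniusRange K A p).val) := by
  obtain ⟨c, w, hw, rfl⟩ := (mem_constSupSq_iff ε).mp ha
  rw [map_add, Algebra.algebraMap_eq_smul_one, frobeniusOnto_smul, map_one]
  refine add_mem (Submodule.smul_mem _ _ (one_mem_constSupSq _)) (mem_constSupSq_of_mem_sq _ ?_)
  rw [← map_frobeniusOnto_ker, ← Ideal.map_pow]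
  exact Ideal.mem_map_of_mem _ hw

/-- Frobenius maps `m²` onto the square of the augmentation ideal of `A^p`, and scalars have `p`-th
roots; so `a^p = w^p` with `w` in `K + m²`. -/
theorem exists_pow_eq_zero_of_frobeniusOnto_mem {ε : A →ₐ[K] K} {a : A}
    (ha : frobeniusOnto K A p a ∈ constSupSq (ε.comp (frobeniusRange K A p).val)) :
    ∃ w ∈ constSupSq ε, (a - w) ^ p = 0 := by
  obtain ⟨c, w, hw, h⟩ := (mem_constSupSq_iff _).mp ha
  rw [← map_frobeniusOnto_ker, ← Ideal.map_pow,
    Ideal.mem_map_iff_of_surjective _ (frobeniusOnto_surjective p)] at hw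
  obtain ⟨v, hv, rfl⟩ := hw
  refine ⟨algebraMap K A ((frobeniusEquiv K p).symm c) + v,
    (mem_constSupSq_iff ε).mpr ⟨_, v, hv, rfl⟩, ?_⟩
  rw [← coe_frobeniusOnto (K := K), ZeroMemClass.coe_eq_zero, map_sub, map_add, h,
    Algebra.algebraMap_eq_smul_one (A := A), frobeniusOnto_smul, map_one, frobeniusEquiv_symm_pow_p,
    Algebra.algebraMap_eq_smul_one, sub_self]

end

/-! ### Induction on dimension: a truncated cotangent basis -/

section
universe u
variable {K : Type*} [Field K] (p : ℕ) [hp : Fact p.Prime] [CharP K p] [PerfectRing K p]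

/-- A basis of the cotangent space at the identity made of elements killed by powers of Frobenius,
whose exponents are accounted for by the dimension of `A`. -/
def HasTruncatedBasis {A : Type u} [CommRing A] [Algebra K A] (ε : A →ₐ[K] K) : Prop :=
  ∃ (ι : Type u) (_ : Fintype ι) (x : ι → A) (e : ι → ℕ), (∀ i, 1 ≤ e i) ∧
    (∀ i, x i ^ p ^ e i = 0) ∧ LinearIndependent K (fun i => (constSupSq ε).mkQ (x i)) ∧
    Submodule.span K (Set.range fun i => (constSupSq ε).mkQ (x i)) = ⊤ ∧
    p ^ (∑ i, e i) ≤ Module.finrank K A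

/-- The image of `T` spans the quotient by the span of `x`; lift to `T` a basis chosen inside that
image. -/
theorem exists_linearIndependent_sum_of_span_sup {V : Type u} [AddCommGroup V] [Module K V]
    [Module.Finite K V] {ι : Type*} {x : ι → V} (hx : LinearIndependent K x) {T : Set V}
    (hT : Submodule.span K (Set.range x) ⊔ Submodule.span K T = ⊤) :
    ∃ (κ : Type u) (_ : Fintype κ) (z : κ → V), (∀ k, z k ∈ T) ∧
      LinearIndependent K (Sum.elim x z) ∧ Submodule.span K (Set.range (Sum.elim x z)) = ⊤ := by
  set W := Submodule.span K (Set.range x) with hW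
  obtain ⟨b, hbT, hbspan, hb⟩ := exists_linearIndependent K (W.mkQ '' T)
  have : Finite b := hb.finite
  choose z hzT hz using fun k : b => hbT k.2
  refine ⟨b, Fintype.ofFinite b, z, hzT, ?_, ?_⟩
  · have hf : LinearIndependent K fun i => (⟨x i, Submodule.subset_span ⟨i, rfl⟩⟩ : W) :=
      LinearIndependent.of_comp W.subtype hx
    refine LinearIndependent.sumElim_of_quotient hf z ?_
    rwa [show Submodule.Quotient.mk ∘ z = Subtype.val from funext hz]
  · rw [Set.Sum.elim_range, Submodule.span_union, ← hW, ← Submodule.map_mkQ_eq_top,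
      Submodule.map_span, ← Set.range_comp]
    have : Set.range (W.mkQ ∘ z) = b := by
      rw [show W.mkQ ∘ z = Subtype.val from funext hz, Subtype.range_coe]
    rw [this, hbspan, ← Submodule.map_span, Submodule.map_mkQ_eq_top, hT]

theorem HasTruncatedBasis.of_frobeniusRange {A : Type u} [CommRing A] [Algebra K A]
    [Module.Finite K A] [CharP A p] {ε : A →ₐ[K] K}
    (hε : ∀ a, ε a = 0 → IsNilpotent a) (Δ : A →ₐ[K] A ⊗[K] A)
    (hr : ∀ a, evalRight ε (Δ a) = a) (hl : ∀ a, evalLeft ε (Δ a) = a)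
    (h : HasTruncatedBasis p (ε.comp (frobeniusRange K A p).val)) : HasTruncatedBasis p ε := by
  obtain ⟨ι, _, y, e, he, hy, hli, hspan, hcard⟩ := h
  choose x hx using fun i => frobeniusOnto_surjective p (y i)
  have hsum : ∀ g : ι → K, frobeniusOnto K A p (∑ i, g i • x i) = ∑ i, g i ^ p • y i := by
    intro g
    simp only [map_sum, frobeniusOnto_smul, hx]
  have hxli : LinearIndependent K fun i => (constSupSq ε).mkQ (x i) := by
    rw [Fintype.linearIndependent_iff] at hli ⊢
    intro g hg i
    have hmem : ∑ i, g i • x i ∈ constSupSq ε := by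
      rw [← Submodule.Quotient.mk_eq_zero, ← Submodule.mkQ_apply, map_sum]
      simpa only [map_smul] using hg
    have h2 := (Submodule.Quotient.mk_eq_zero _).mpr (frobeniusOnto_mem_constSupSq p hmem)
    rw [hsum, ← Submodule.mkQ_apply, map_sum] at h2
    simp only [map_smul] at h2
    exact eq_zero_of_pow_eq_zero (hli (fun i => g i ^ p) h2 i)
  -- Subtracting from `a` a combination of the `x i` that matches `a^p` in the cotangent space of
  -- `A^p` leaves, modulo `K + m²`, an element with zero `p`-th power.
  have htop : Submodule.span K (Set.range fun i => (constSupSq ε).mkQ (x i)) ⊔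
      Submodule.span K ((constSupSq ε).mkQ '' {z | z ^ p = 0}) = ⊤ := by
    rw [eq_top_iff]
    intro v _
    obtain ⟨a, rfl⟩ := (constSupSq ε).mkQ_surjective v
    have hmem : (constSupSq (ε.comp (frobeniusRange K A p).val)).mkQ (frobeniusOnto K A p a) ∈
      Submodule.span K (Set.range fun i => (constSupSq _).mkQ (y i)) := by
      rw [hspan]; trivial
    obtain ⟨c, hc⟩ := (Submodule.mem_span_range_iff_exists_fun K).mp hmem
    have h2 : frobeniusOnto K A p (a - ∑ i, (frobeniusEquiv K p).symm (c i) • x i) ∈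
        constSupSq (ε.comp (frobeniusRange K A p).val) := by
      rw [← Submodule.Quotient.mk_eq_zero, map_sub, hsum, ← Submodule.mkQ_apply, map_sub, map_sum]
      simp only [frobeniusEquiv_symm_pow_p, map_smul]
      rw [hc, sub_self]
    obtain ⟨w, hw, hz⟩ := exists_pow_eq_zero_of_frobeniusOnto_mem p h2
    have hw0 : (constSupSq ε).mkQ w = 0 := by simpa using hw
    refine Submodule.mem_sup.mpr
      ⟨(constSupSq ε).mkQ (∑ i, (frobeniusEquiv K p).symm (c i) • x i), ?_, _,
        Submodule.subset_span ⟨_, hz, rfl⟩, ?_⟩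
    · rw [map_sum]
      exact sum_mem fun i _ => by
        rw [map_smul]
        exact Submodule.smul_mem _ _ (Submodule.subset_span ⟨i, rfl⟩)
    · rw [map_sub, map_sub, hw0]; abel
  obtain ⟨κ, _, v, hv, hli', hspan'⟩ := exists_linearIndependent_sum_of_span_sup hxli htop
  choose z hz hzv using hv
  have helim : Sum.elim (fun i => (constSupSq ε).mkQ (x i)) v =
      fun s => (constSupSq ε).mkQ (Sum.elim x z s) := by
    funext s
    cases s with
    | inl i => rfl
    | inr k => exact (hzv k).symm
  rw [helim] at hli' hspan'
  -- Taking roots raises each old exponent by one, and each new element has exponent one: together a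
  -- factor `p^(|ι| + |κ|)`, matched by `pow_card_mul_finrank_le`.
  refine ⟨ι ⊕ κ, inferInstance, Sum.elim x z, Sum.elim (fun i => e i + 1) fun _ => 1, ?_, ?_,
    hli', hspan', ?_⟩
  · rintro (i | k) <;> simp
  · rintro (i | k)
    · have h := congrArg Subtype.val (hy i)
      rw [← hx i, SubmonoidClass.coe_pow, coe_frobeniusOnto, ← pow_mul, ← pow_succ'] at h
      exact h
    · simpa using hz k
  · refine le_trans ?_ (pow_card_mul_finrank_le p hε Δ hr hl hli')
    refine le_trans (le_of_eq ?_) (Nat.mul_le_mul_left _ hcard)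
    rw [← pow_add]
    congr 1
    simp [Finset.sum_add_distrib]
    ring

theorem hasTruncatedBasis_of_finrank_le (N : ℕ) (A : Type u) [CommRing A] [Algebra K A]
    [Module.Finite K A] [CharP A p] (ε : A →ₐ[K] K)
    (hε : ∀ a, ε a = 0 → IsNilpotent a) (Δ : A →ₐ[K] A ⊗[K] A)
    (hr : ∀ a, evalRight ε (Δ a) = a) (hl : ∀ a, evalLeft ε (Δ a) = a)
    (hN : Module.finrank K A ≤ N) : HasTruncatedBasis p ε := by
  have : Nontrivial A := ε.toRingHom.domain_nontrivial
  induction N generalizing A with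
  | zero => exact absurd (Module.finrank_pos (R := K) (M := A)) (by omega)
  | succ N ih =>
    rcases subsingleton_or_nontrivial (A ⧸ constSupSq ε) with hV | hV
    · exact ⟨PEmpty, inferInstance, PEmpty.elim, PEmpty.elim, fun i => i.elim, fun i => i.elim,
        linearIndependent_empty_type, Subsingleton.elim _ _,
        by simpa using Nat.succ_le_of_lt (Module.finrank_pos (R := K) (M := A))⟩
    · refine HasTruncatedBasis.of_frobeniusRange p hε Δ hr hl ?_
      obtain ⟨Δ', hΔ'⟩ := exists_comul_frobeniusRange p ε Δ
      refine ih (frobeniusRange K A p) _ ?_ Δ' ?_ ?_ ?_ inferInstance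
      · intro b hb
        obtain ⟨n, hn⟩ := hε b hb
        exact ⟨n, Subtype.ext (by simpa using hn)⟩
      · intro b
        rw [← Subtype.coe_inj, ← evalRight_map_val, hΔ', hr]
      · intro b
        rw [← Subtype.coe_inj, ← evalLeft_map_val, hΔ', hl]
      -- A nonzero cotangent space forces `2 * dim A^p ≤ dim A`, so the dimension drops.
      · let bV := Module.finBasis K (A ⧸ constSupSq ε)
        choose x hx using fun i => (constSupSq ε).mkQ_surjective (bV i)
        have hxli : LinearIndependent K fun i => (constSupSq ε).mkQ (x i) := by
          simpa only [hx] using bV.linearIndependent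
        have h := pow_card_mul_finrank_le p hε Δ hr hl hxli
        rw [Fintype.card_fin] at h
        have h2 : 2 ≤ p ^ Module.finrank K (A ⧸ constSupSq ε) :=
          hp.out.two_le.trans (Nat.le_self_pow Module.finrank_pos.ne' p)
        have h3 : 0 < Module.finrank K (frobeniusRange K A p) := Module.finrank_pos
        nlinarith

end

/-! ### Generators, presentation and the Nullstellensatz -/

section
variable {K A : Type*} [Field K] [CommRing A] [Algebra K A]

theorem adjoin_eq_top_of_span_cotangent [Module.Finite K A] {ε : A →ₐ[K] K}
    (hε : ∀ a, ε a = 0 → IsNilpotent a) {ι : Type*} [Fintype ι] {x : ι → A}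
    (hx0 : ∀ i, ε (x i) = 0)
    (hspan : Submodule.span K (Set.range fun i => (constSupSq ε).mkQ (x i)) = ⊤) :
    Algebra.adjoin K (Set.range x) = ⊤ := by
  have : IsNoetherianRing A := IsNoetherianRing.of_finite K A
  -- Nakayama: the nil ideal `m` lies in the Jacobson radical, and `m ≤ (x) + m²`.
  have hker : RingHom.ker ε ≤ Ideal.span (Set.range x) := by
    refine Submodule.le_of_le_smul_of_le_jacobson_bot (I := RingHom.ker ε)
      (IsNoetherian.noetherian _) ?_ ?_
    · intro a ha
      rw [Ideal.mem_jacobson_bot]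
      intro y
      refine isUnit_of_map_ne_zero hε ?_
      simp [(RingHom.mem_ker).mp ha]
    · intro a ha
      have hmem : (constSupSq ε).mkQ a ∈
          Submodule.span K (Set.range fun i => (constSupSq ε).mkQ (x i)) := by
        rw [hspan]; trivial
      obtain ⟨c, hc⟩ := (Submodule.mem_span_range_iff_exists_fun K).mp hmem
      have h2 : a - ∑ i, c i • x i ∈ constSupSq ε := by
        rw [← Submodule.Quotient.mk_eq_zero, ← Submodule.mkQ_apply, map_sub, map_sum]
        simp only [map_smul]
        rw [hc, sub_self]
      obtain ⟨d, w, hw, hdw⟩ := (mem_constSupSq_iff ε).mp h2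
      have hεw : ε w = 0 := Ideal.pow_le_self two_ne_zero hw
      have hd : d = 0 := by
        have h3 := congrArg ε hdw
        simp only [map_sub, map_sum, map_smul, hx0, map_add, hεw, (RingHom.mem_ker).mp ha,
          AlgHom.commutes] at h3
        simpa using h3.symm
      rw [hd, map_zero, zero_add, sub_eq_iff_eq_add'] at hdw
      rw [hdw]
      refine Submodule.add_mem_sup (sum_mem fun i _ => ?_) ?_
      · rw [Algebra.smul_def]
        exact Ideal.mul_mem_left _ _ (Ideal.subset_span ⟨i, rfl⟩)
      · rwa [smul_eq_mul, ← pow_two]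
  -- Approximation by polynomials in `x` modulo `m^k`; it becomes exact because `m` is nilpotent.
  have happrox : ∀ (k : ℕ) (a : A), ∃ s ∈ Algebra.adjoin K (Set.range x),
      a - s ∈ RingHom.ker ε ^ k := by
    intro k
    induction k with
    | zero => exact fun a => ⟨0, zero_mem _, by simp⟩
    | succ k ih =>
      intro a
      obtain ⟨c, hc⟩ := (Ideal.mem_span_range_iff_exists_fun).mp
        (hker (sub_algebraMap_mem_ker ε a))
      choose s hs hcs using fun i => ih (c i)
      refine ⟨algebraMap K A (ε a) + ∑ i, s i * x i, add_mem (Subalgebra.algebraMap_mem _ _)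
        (sum_mem fun i _ => mul_mem (hs i) (Algebra.subset_adjoin ⟨i, rfl⟩)), ?_⟩
      rw [← sub_sub, ← hc, ← Finset.sum_sub_distrib, pow_succ]
      refine sum_mem fun i _ => ?_
      rw [← sub_mul]
      exact Ideal.mul_mem_mul (hcs i) (hx0 i)
  obtain ⟨k, hk⟩ := Ideal.exists_pow_le_of_le_radical_of_fg (I := RingHom.ker ε) (J := ⊥)
    (fun a ha => mem_nilradical.mpr (hε a ha)) (IsNoetherian.noetherian _)
  rw [eq_top_iff]
  intro a _
  obtain ⟨s, hs, has⟩ := happrox k a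
  have h0 : a - s = 0 := hk has
  rwa [sub_eq_zero.mp h0]

variable (K) in
theorem span_range_mk_monomial_eq_top {ι : Type*} [Fintype ι] (N : ι → ℕ) :
    Submodule.span K (Set.range fun α : (∀ i, Fin (N i)) =>
      Ideal.Quotient.mk (Ideal.span (Set.range fun i => (MvPolynomial.X i : MvPolynomial ι K) ^ N i))
        (MvPolynomial.monomial (Finsupp.equivFunOnFinite.symm fun i => (α i : ℕ)) 1)) = ⊤ := by
  rw [eq_top_iff]
  intro q _
  obtain ⟨P, rfl⟩ := Ideal.Quotient.mk_surjective q
  induction P using MvPolynomial.induction_on' with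
  | add P Q hP hQ => rw [map_add]; exact add_mem (hP trivial) (hQ trivial)
  | monomial m a =>
    by_cases hm : ∀ i, m i < N i
    · have h : MvPolynomial.monomial m a = a • MvPolynomial.monomial m (1 : K) := by
        rw [MvPolynomial.smul_monomial, smul_eq_mul, mul_one]
      have hm' : (Finsupp.equivFunOnFinite.symm fun i => ((⟨m i, hm i⟩ : Fin (N i)) : ℕ)) = m :=
        Finsupp.ext fun i => rfl
      have hmem := Submodule.subset_span (R := K) (Set.mem_range_self
        (f := fun α : (∀ i, Fin (N i)) => Ideal.Quotient.mk (Ideal.span (Set.range fun i =>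
          (MvPolynomial.X i : MvPolynomial ι K) ^ N i)) (MvPolynomial.monomial
            (Finsupp.equivFunOnFinite.symm fun i => (α i : ℕ)) 1)) fun i => ⟨m i, hm i⟩)
      simp only [hm'] at hmem
      rw [h]
      exact Submodule.smul_mem _ a hmem
    · push Not at hm
      obtain ⟨i, hi⟩ := hm
      have hz : Ideal.Quotient.mk (Ideal.span (Set.range fun i =>
          (MvPolynomial.X i : MvPolynomial ι K) ^ N i)) (MvPolynomial.monomial m a) = 0 := by
        rw [Ideal.Quotient.eq_zero_iff_mem]
        refine Ideal.mem_of_dvd _ ?_ (Ideal.subset_span ⟨i, rfl⟩)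
        simp only [MvPolynomial.X_pow_eq_monomial]
        rw [MvPolynomial.monomial_dvd_monomial]
        exact ⟨Or.inr (Finsupp.single_le_iff.mpr hi), one_dvd _⟩
      rw [hz]
      exact zero_mem _

/-- An algebra generated by nilpotent elements is a truncated polynomial algebra as soon as its
dimension is as large as the nilpotency exponents permit. -/
theorem nonempty_algEquiv_truncated [Module.Finite K A] {ι : Type*} [Fintype ι] {x : ι → A}
    (hx : Algebra.adjoin K (Set.range x) = ⊤) (N : ι → ℕ) (hN : ∀ i, x i ^ N i = 0)
    (hcard : ∏ i, N i ≤ Module.finrank K A) :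
    Nonempty (A ≃ₐ[K] (MvPolynomial ι K ⧸
      Ideal.span (Set.range fun i => (MvPolynomial.X i : MvPolynomial ι K) ^ N i))) := by
  classical
  set J := Ideal.span (Set.range fun i => (MvPolynomial.X i : MvPolynomial ι K) ^ N i)
  have hJ : ∀ P ∈ J, MvPolynomial.aeval x P = 0 := by
    have : J ≤ RingHom.ker (MvPolynomial.aeval x : MvPolynomial ι K →ₐ[K] A) := by
      rw [Ideal.span_le]
      rintro _ ⟨i, rfl⟩
      simp [RingHom.mem_ker, hN]
    exact this
  let f : (MvPolynomial ι K ⧸ J) →ₐ[K] A := Ideal.Quotient.liftₐ J (MvPolynomial.aeval x) hJ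
  have hf : Function.Surjective f := by
    refine Ideal.Quotient.lift_surjective_of_surjective _ _ ?_
    rw [← MvPolynomial.aeval_range] at hx
    exact (AlgHom.range_eq_top _).mp hx
  have hspan := span_range_mk_monomial_eq_top K N
  have : Module.Finite K (MvPolynomial ι K ⧸ J) :=
    ⟨⟨(Set.finite_range _).toFinset, by rw [Set.Finite.coe_toFinset]; exact hspan⟩⟩
  have hle : Module.finrank K (MvPolynomial ι K ⧸ J) ≤ ∏ i, N i := by
    have h := finrank_range_le_card (R := K) fun α : (∀ i, Fin (N i)) => Ideal.Quotient.mk J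
        (MvPolynomial.monomial (Finsupp.equivFunOnFinite.symm fun i => (α i : ℕ)) 1)
    rw [Set.finrank, hspan, finrank_top] at h
    simpa using h
  have hge : Module.finrank K A ≤ Module.finrank K (MvPolynomial ι K ⧸ J) :=
    LinearMap.finrank_le_finrank_of_surjective (f := f.toLinearMap) hf
  have hinj : Function.Injective f :=
    (LinearMap.injective_iff_surjective_of_finrank_eq_finrank (f := f.toLinearMap)
      (le_antisymm (hle.trans hcard) hge)).mpr hf
  exact ⟨(AlgEquiv.ofBijective f ⟨hinj, hf⟩).symm⟩

/-- Every maximal ideal has residue field `K`, so it defines a point, which must be `ε`. Thus `ker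
ε` lies in the Jacobson radical, which is the nilradical here. -/
theorem isNilpotent_of_unique_algHom [IsAlgClosed K] [Algebra.FiniteType K A] {ε : A →ₐ[K] K}
    (hε : ∀ g : A →ₐ[K] K, g = ε) {a : A} (ha : ε a = 0) : IsNilpotent a := by
  have : IsJacobsonRing A := isJacobsonRing_of_finiteType (A := K)
  rw [← mem_nilradical, nilradical, Ideal.zero_eq_bot, Ideal.radical_eq_jacobson,
    Ideal.jacobson, Ideal.mem_sInf]
  rintro m ⟨-, hm⟩
  let _ : Field (A ⧸ m) := Ideal.Quotient.field m
  have : Module.Finite K (A ⧸ m) := finite_of_finite_type_of_isJacobsonRing K (A ⧸ m)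
  have hbij : Function.Bijective (Algebra.ofId K (A ⧸ m)) :=
    IsAlgClosed.algebraMap_bijective_of_isIntegral
  let e := AlgEquiv.ofBijective (Algebra.ofId K (A ⧸ m)) hbij
  have h : e.symm (Ideal.Quotient.mkₐ K m a) = 0 := by
    rw [← ha, ← hε (e.symm.toAlgHom.comp (Ideal.Quotient.mkₐ K m))]
    rfl
  rw [EmbeddingLike.map_eq_zero_iff] at h
  exact Ideal.Quotient.eq_zero_iff_mem.mp h

theorem finite_of_isNilpotent_ker [Algebra.FiniteType K A] {ε : A →ₐ[K] K}
    (hε : ∀ a, ε a = 0 → IsNilpotent a) : Module.Finite K A := by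
  have : Algebra.IsIntegral K A := by
    constructor
    intro a
    obtain ⟨n, hn⟩ := hε _ (sub_algebraMap_mem_ker ε a)
    have h : IsIntegral K (a - algebraMap K A (ε a)) :=
      ⟨Polynomial.X ^ n, Polynomial.monic_X_pow n, by simpa using hn⟩
    simpa using h.add (isIntegral_algebraMap (x := ε a))
  exact Algebra.IsIntegral.finite

theorem bijective_algebraMap_of_constSupSq_eq_top [Module.Finite K A] {ε : A →ₐ[K] K}
    (hε : ∀ a, ε a = 0 → IsNilpotent a) (h : constSupSq ε = ⊤) :
    Function.Bijective (algebraMap K A) := by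
  have : Nontrivial A := ε.toRingHom.domain_nontrivial
  refine ⟨(algebraMap K A).injective, ?_⟩
  have hV : Subsingleton (A ⧸ constSupSq ε) := Submodule.Quotient.subsingleton_iff.mpr h
  have hadj := adjoin_eq_top_of_span_cotangent hε (ι := Empty) (x := Empty.elim) (fun i => i.elim)
    (Subsingleton.elim _ _)
  rw [Set.range_eq_empty, Algebra.adjoin_empty] at hadj
  intro a
  exact Algebra.mem_bot.mp (hadj ▸ Algebra.mem_top)

end

/-! ### Counit laws and the main equivalence -/

section
variable {K H : Type*} [Field K] [CommRing H] [Bialgebra K H]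

theorem evalRight_comul (a : H) :
    evalRight (Bialgebra.counitAlgHom K H) (Bialgebra.comulAlgHom K H a) = a := by
  have h : ∀ u : H ⊗[K] H, evalRight (Bialgebra.counitAlgHom K H) u =
      TensorProduct.rid K H (Coalgebra.counit.lTensor H u) := by
    intro u
    induction u with
    | zero => simp
    | add x y hx hy => simp only [map_add, hx, hy]
    | tmul a b => simp
  rw [h]
  simp

theorem evalLeft_comul (a : H) :
    evalLeft (Bialgebra.counitAlgHom K H) (Bialgebra.comulAlgHom K H a) = a := by
  have h : ∀ u : H ⊗[K] H, evalLeft (Bialgebra.counitAlgHom K H) u =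
      TensorProduct.lid K H (Coalgebra.counit.rTensor H u) := by
    intro u
    induction u with
    | zero => simp
    | add x y hx hy => simp only [map_add, hx, hy]
    | tmul a b => simp
  rw [h]
  simp

end

theorem algHom_truncated_ext {K ι : Type*} [Field K] {N : ι → ℕ}
    (f g : (MvPolynomial ι K ⧸ Ideal.span (Set.range fun i : ι =>
      (MvPolynomial.X i : MvPolynomial ι K) ^ N i)) →ₐ[K] K) : f = g := by
  have hzero : ∀ (φ : (MvPolynomial ι K ⧸ Ideal.span (Set.range fun i : ι =>
      (MvPolynomial.X i : MvPolynomial ι K) ^ N i)) →ₐ[K] K) (i : ι),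
      φ (Ideal.Quotient.mkₐ K _ (MvPolynomial.X i)) = 0 := by
    intro φ i
    refine eq_zero_of_pow_eq_zero (n := N i) ?_
    rw [← map_pow, ← map_pow, Ideal.Quotient.mkₐ_eq_mk,
      Ideal.Quotient.eq_zero_iff_mem.mpr (Ideal.subset_span (Set.mem_range_self i)), map_zero]
  refine Ideal.Quotient.algHom_ext _ (MvPolynomial.algHom_ext fun i => ?_)
  exact (hzero f i).trans (hzero g i).symm

theorem HasTruncatedBasis.bijective_or_exists_algEquiv {K A : Type*} [Field K] [CommRing A]
    [Algebra K A] [Module.Finite K A] (p : ℕ) {ε : A →ₐ[K] K}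
    (hε : ∀ a, ε a = 0 → IsNilpotent a) (h : HasTruncatedBasis p ε) :
    Function.Bijective (algebraMap K A) ∨ ∃ n : ℕ, 1 ≤ n ∧ ∃ e : Fin n → ℕ, (∀ i, 1 ≤ e i) ∧
      Nonempty (A ≃ₐ[K] (MvPolynomial (Fin n) K ⧸ Ideal.span (Set.range fun i : Fin n =>
        (MvPolynomial.X i : MvPolynomial (Fin n) K) ^ p ^ e i))) := by
  obtain ⟨ι, _, x, e, he, hx, -, hspan, hcard⟩ := h
  rcases isEmpty_or_nonempty ι with hι | hι
  -- An empty basis means a zero cotangent space; this is alternative (a).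
  · left
    refine bijective_algebraMap_of_constSupSq_eq_top hε (Submodule.Quotient.subsingleton_iff.mp ?_)
    rw [Set.range_eq_empty, Submodule.span_empty] at hspan
    exact (Submodule.subsingleton_iff K).mp (subsingleton_of_bot_eq_top hspan)
  · right
    have hx0 : ∀ i, ε (x i) = 0 := fun i =>
      eq_zero_of_pow_eq_zero (by rw [← map_pow, hx i, map_zero])
    let σ := Fintype.equivFin ι
    refine ⟨Fintype.card ι, Fintype.card_pos, e ∘ σ.symm, fun i => he _, ?_⟩
    refine nonempty_algEquiv_truncated (x := x ∘ σ.symm) ?_ _ (fun i => hx _) ?_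
    · rw [EquivLike.range_comp]
      exact adjoin_eq_top_of_span_cotangent hε hx0 hspan
    · rw [Finset.prod_pow_eq_pow_sum]
      refine le_trans (le_of_eq ?_) hcard
      rw [← Equiv.sum_comp σ.symm e]
      rfl

theorem mainTheorem9 {K : Type*} [Field K] [IsAlgClosed K]
    {H : Type*} [CommRing H] [HopfAlgebra K H] [Algebra.FiniteType K H] :
    (∃ f : H →ₐ[K] K, ∀ g : H →ₐ[K] K, g = f) ↔
      (Function.Bijective (algebraMap K H) ∨
        ∃ p : ℕ, p.Prime ∧ CharP K p ∧
          ∃ n : ℕ, 1 ≤ n ∧ ∃ e : Fin n → ℕ, (∀ i, 1 ≤ e i) ∧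
            Nonempty (H ≃ₐ[K]
              (MvPolynomial (Fin n) K ⧸
                Ideal.span (Set.range fun i : Fin n =>
                  (MvPolynomial.X i : MvPolynomial (Fin n) K) ^ p ^ e i)))) := by
  constructor
  · rintro ⟨f, hf⟩
    have hcounit : ∀ g : H →ₐ[K] K, g = Bialgebra.counitAlgHom K H :=
      fun g => (hf g).trans (hf _).symm
    have hε : ∀ a, Bialgebra.counitAlgHom K H a = 0 → IsNilpotent a :=
      fun a ha => isNilpotent_of_unique_algHom hcounit ha
    have : Module.Finite K H := finite_of_isNilpotent_ker hε
    have : Nontrivial H := f.toRingHom.domain_nontrivial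
    rcases CharP.exists' K with h0 | ⟨p, hp, hchar⟩
    · exact Or.inl (bijective_algebraMap_of_constSupSq_eq_top hε
        (constSupSq_eq_top_of_charZero hε _ evalRight_comul evalLeft_comul))
    · have : CharP H p := charP_of_injective_algebraMap (algebraMap K H).injective p
      have hT := hasTruncatedBasis_of_finrank_le p _ H _ hε _ evalRight_comul evalLeft_comul le_rfl
      exact (hT.bijective_or_exists_algEquiv p hε).imp_right fun h => ⟨p, hp.out, hchar, h⟩
  · rintro (h | ⟨p, -, -, n, -, e, -, ⟨σ⟩⟩)
    · refine ⟨Bialgebra.counitAlgHom K H, fun g => AlgHom.ext fun a => ?_⟩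
      obtain ⟨c, rfl⟩ := h.2 a
      rw [AlgHom.commutes, AlgHom.commutes]
    · refine ⟨Bialgebra.counitAlgHom K H, fun g => AlgHom.ext fun a => ?_⟩
      have h := algHom_truncated_ext (g.comp σ.symm.toAlgHom)
        ((Bialgebra.counitAlgHom K H).comp σ.symm.toAlgHom)
      simpa using DFunLike.congr_fun h (σ a)
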